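/- Let $G$ be a (finite-dimensional) Lie group acting smoothly and transitively on a connected smooth manifold $M$, with action $\lambda_g(m)=g\cdot m$, and fix an origin $o\in M$. A *spray* on $M$ is a smooth vector field $S$ on $TM\setminus\{0\}$ with $JS=C$ and $[C,S]=S$, where $J=dx^i\otimes\partial/\partial y^i$ is the vertical endomorphism and $C=y^i\,\partial/\partial y^i$ the Liouville field; its *geodesics* are the curves $\gamma\colon I\to M$ ($I$ an open interval) whose velocity $\dot\gamma$ is an integral curve of $S$ in $TM\setminus\{0\}$. The spray $S$ is a *geodesic orbit (g.o.) spray* if it is $G$-invariant and every geodesic $\gamma\colon I\to M$ of $S$ with $0\in I$ and $\gamma(0)=o$ is of the form $\gamma(t)=\exp(tX)\cdot o$ $(t\in I)$ for some $X$ in the Lie algebra of $G$. The *geodesics* of a Riemann metric $g$ (resp. of a positively homogeneous, not necessarily reversible, Finsler metric $F$) are the curves with nowhere vanishing velocity that solve the Euler–Lagrange equation of the energy $E(v)=\tfrac12 g(v,v)$ (resp. $E=\tfrac12F^2$). Two families of curves are *projectively equivalent* if they coincide up to orientation preserving reparameterization. A spray $S$ is *invariant Riemann (resp. Finsler) metrizable*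 if there is a $G$-invariant Riemann (resp. Finsler) metric on $M$ whose geodesics coincide, as parametrised curves, with the geodesics of $S$; it is *invariant projectively Riemann (resp. Finsler) metrizable* if there is a $G$-invariant Riemann (resp. Finsler) metric on $M$ whose geodesics are projectively equivalent to the geodesics of $S$. **Proposition.** Let $S$ be a g.o. spray on $M$. Then $S$ is invariant projectively Riemann metrizable if and only if it is invariant Riemann metrizable, and $S$ is invariant projectively Finsler metrizable if and only if it is invariant Finsler metrizable. -/

import Mathlib

open Set Function Bundle
open scoped Manifold ContDiff Topology

noncomputable section

/-! ## Sprays on a manifold `M` modelled on a finite-dimensional vector space `E` -/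

section Sprays

variable {E : Type*} [NormedAddCommGroup E] [NormedSpace ℝ E]
  {M : Type*} [TopologicalSpace M] [ChartedSpace E M] [IsManifold 𝓘(ℝ, E) ∞ M]

variable (E M) in
/-- `TM ∖ {0}`: the set of nonzero tangent vectors. -/
def slitTangentBundle : Set (TangentBundle 𝓘(ℝ, E) M) := {v | v.snd ≠ 0}

/-- The vertical lift to `T_v TM` of a vector `w` tangent to `M` at the base point of `v`:
the derivative at `v` of the inclusion of the fibre `T_x M ⊆ TM`, applied to `w`. -/
def verticalLift (v : TangentBundle 𝓘(ℝ, E) M) (w : E) : TangentSpace 𝓘(ℝ, E).tangent v :=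
  mfderiv 𝓘(ℝ, E) 𝓘(ℝ, E).tangent
    (fun y : E => (⟨v.proj, y⟩ : TangentBundle 𝓘(ℝ, E) M)) v.snd w

variable (E M) in
/-- The Liouville vector field `C = yⁱ ∂/∂yⁱ` on `TM`. -/
def liouvilleField (v : TangentBundle 𝓘(ℝ, E) M) : TangentSpace 𝓘(ℝ, E).tangent v :=
  verticalLift v v.snd

/-- The canonical vertical endomorphism `J = dxⁱ ⊗ ∂/∂yⁱ` of `TTM`:
project to `TM` by `dπ`, then lift vertically. -/
def verticalEndomorphism (v : TangentBundle 𝓘(ℝ, E) M) (ξ : TangentSpace 𝓘(ℝ, E).tangent v) :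
    TangentSpace 𝓘(ℝ, E).tangent v :=
  verticalLift v
    (mfderiv 𝓘(ℝ, E).tangent 𝓘(ℝ, E)
      (TotalSpace.proj : TangentBundle 𝓘(ℝ, E) M → M) v ξ)

variable (E M) in
/-- A spray: a smooth vector field `S` on `TM ∖ {0}` with `J S = C` and `[C, S] = S`.
The values of `toFun` at zero tangent vectors are irrelevant. -/
structure Spray where
  toFun : (v : TangentBundle 𝓘(ℝ, E) M) → TangentSpace 𝓘(ℝ, E).tangent v
  smooth : ContMDiffOn 𝓘(ℝ, E).tangent 𝓘(ℝ, E).tangent.tangent ∞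
    (fun v => (⟨v, toFun v⟩ : TangentBundle 𝓘(ℝ, E).tangent (TangentBundle 𝓘(ℝ, E) M)))
    (slitTangentBundle E M)
  vertical_eq : ∀ v ∈ slitTangentBundle E M, verticalEndomorphism v (toFun v) = liouvilleField E M v
  bracket_eq : ∀ v ∈ slitTangentBundle E M,
    VectorField.mlieBracket 𝓘(ℝ, E).tangent (liouvilleField E M) toFun v = toFun v

/-! ## Curves and families of curves -/

/-- The velocity `γ̇(t)` of a curve, as a point of `TM`. -/
def velocity (E : Type*) [NormedAddCommGroup E] [NormedSpace ℝ E]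
    {M : Type*} [TopologicalSpace M] [ChartedSpace E M] (γ : ℝ → M) (t : ℝ) :
    TangentBundle 𝓘(ℝ, E) M :=
  ⟨γ t, mfderiv 𝓘(ℝ, ℝ) 𝓘(ℝ, E) γ t (1 : ℝ)⟩

/-- Open intervals of the real line (possibly unbounded). -/
def IsOpenInterval (I : Set ℝ) : Prop := IsOpen I ∧ I.OrdConnected ∧ I.Nonempty

/-- A family of parametrised curves in `M`: which pairs `(γ, I)` belong to it, `γ` being a curve
considered on the open interval `I`. -/
abbrev CurveFamily (M : Type*) := (ℝ → M) → Set ℝ → Prop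

/-- `φ` is an orientation preserving (smooth) reparameterization from the interval `J`
onto the interval `I`. -/
def IsReparam (φ : ℝ → ℝ) (J I : Set ℝ) : Prop :=
  IsOpenInterval J ∧ φ '' J = I ∧ ContDiffOn ℝ ∞ φ J ∧ ∀ t ∈ J, 0 < deriv φ t

/-- Two families of curves coincide as parametrised curves. -/
def CurveFamily.Coincide (A B : CurveFamily M) : Prop := ∀ γ I, A γ I ↔ B γ I

/-- Two families of curves are projectively equivalent: they coincide up to orientation
preserving reparameterization. -/
def CurveFamily.ProjEquiv (A B : CurveFamily M) : Prop :=
  (∀ γ I, A γ I → ∃ φ J, IsReparam φ J I ∧ B (γ ∘ φ) J) ∧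
  (∀ γ I, B γ I → ∃ φ J, IsReparam φ J I ∧ A (γ ∘ φ) J)

/-- The geodesics of a spray: the curves `γ` whose velocity `γ̇` is an integral curve of `S`
in `TM ∖ {0}`. -/
def Spray.geodesics (S : Spray E M) : CurveFamily M := fun γ I =>
  IsOpenInterval I ∧ (∀ t ∈ I, velocity E γ t ∈ slitTangentBundle E M) ∧
    IsMIntegralCurveOn (velocity E γ) S.toFun I

/-! ## Euler–Lagrange equations, Riemann and Finsler metrics -/

/-- The Euler–Lagrange equation `d/dt (∂L/∂y) = ∂L/∂x` for `γ` at the time `t₀`, in the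
coordinates `(x, y)` of `TM` induced by the chart of `M` at `γ t₀`. In these coordinates,
`c t = (x(t), ẋ(t))` represents the velocity of `γ`. -/
def EulerLagrangeAt (L : TangentBundle 𝓘(ℝ, E) M → ℝ) (γ : ℝ → M) (t₀ : ℝ) : Prop :=
  let chart := extChartAt 𝓘(ℝ, E).tangent (velocity E γ t₀)
  let c : ℝ → E × E := fun t => chart (velocity E γ t)
  let ℓ : E × E → ℝ := fun p => L (chart.symm p)
  HasDerivAt (fun t => fderiv ℝ (fun y => ℓ ((c t).1, y)) (c t).2)
    (fderiv ℝ (fun x => ℓ (x, (c t₀).2)) (c t₀).1) t₀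

/-- The geodesics defined by an energy function: the regular curves (that is, with velocity in
`TM ∖ {0}`) solving its Euler–Lagrange equation. -/
def energyGeodesics (L : TangentBundle 𝓘(ℝ, E) M → ℝ) : CurveFamily M := fun γ I =>
  IsOpenInterval I ∧ ContMDiffOn 𝓘(ℝ, ℝ) 𝓘(ℝ, E) 2 γ I ∧
    (∀ t ∈ I, velocity E γ t ∈ slitTangentBundle E M) ∧ ∀ t ∈ I, EulerLagrangeAt L γ t

variable (E M) in
/-- Smooth Riemann metrics on `M`. -/
abbrev RiemannMetric := ContMDiffRiemannianMetric 𝓘(ℝ, E) ∞ E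
  (fun x : M => TangentSpace 𝓘(ℝ, E) x)

/-- The energy `E(v) = g(v, v) / 2` of a Riemann metric. -/
def riemannEnergy (g : RiemannMetric E M) (v : TangentBundle 𝓘(ℝ, E) M) : ℝ :=
  g.inner v.proj v.snd v.snd / 2

variable (E M) in
/-- A (not necessarily reversible) Finsler metric on `M`, given by its Finsler function `F`:
positive and smooth on `TM ∖ {0}`, positively homogeneous of degree one, and such that the Hessian
of the energy `F² / 2` in the fibre directions is positive definite on `TM ∖ {0}`
(the Hessian form at `y`, evaluated on `(w, w)`, is the second derivative along the line
`y + t w`). -/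
structure FinslerMetric where
  F : TangentBundle 𝓘(ℝ, E) M → ℝ
  smooth : ContMDiffOn 𝓘(ℝ, E).tangent 𝓘(ℝ, ℝ) ∞ F (slitTangentBundle E M)
  pos : ∀ v ∈ slitTangentBundle E M, 0 < F v
  homogeneous : ∀ (x : M) (y : TangentSpace 𝓘(ℝ, E) x) (c : ℝ), 0 ≤ c →
    F ⟨x, c • y⟩ = c * F ⟨x, y⟩
  hessian_pos : ∀ (x : M) (y w : TangentSpace 𝓘(ℝ, E) x), y ≠ 0 → w ≠ 0 →
    0 < iteratedDeriv 2 (fun t : ℝ => F ⟨x, y + t • w⟩ ^ 2 / 2) 0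

/-- The energy `E = F² / 2` of a Finsler metric. -/
def FinslerMetric.energy (F : FinslerMetric E M) (v : TangentBundle 𝓘(ℝ, E) M) : ℝ :=
  F.F v ^ 2 / 2

/-! ## Invariance under a group action -/

/-- The action of `g` on `TM`, that is `λ_{g*}`. -/
def tangentAction (E : Type*) [NormedAddCommGroup E] [NormedSpace ℝ E]
    {M : Type*} [TopologicalSpace M] [ChartedSpace E M] {G : Type*} [SMul G M] (g : G) :
    TangentBundle 𝓘(ℝ, E) M → TangentBundle 𝓘(ℝ, E) M :=
  tangentMap 𝓘(ℝ, E) 𝓘(ℝ, E) (fun x : M => g • x)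

variable (G : Type*) [Group G] [MulAction G M]

/-- `S` is `G`-invariant: `(λ_g)_{**} S = S` for all `g`. -/
def Spray.Invariant (S : Spray E M) : Prop :=
  ∀ (g : G), ∀ v ∈ slitTangentBundle E M,
    S.toFun (tangentAction E g v) =
      mfderiv 𝓘(ℝ, E).tangent 𝓘(ℝ, E).tangent (tangentAction E g) v (S.toFun v)

/-- `g` is `G`-invariant: every element of `G` acts by isometries. -/
def RiemannInvariant (g : RiemannMetric E M) : Prop :=
  ∀ (a : G) (x : M) (v w : TangentSpace 𝓘(ℝ, E) x),
    g.inner (a • x) (mfderiv 𝓘(ℝ, E) 𝓘(ℝ, E) (fun z : M => a • z) x v)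
      (mfderiv 𝓘(ℝ, E) 𝓘(ℝ, E) (fun z : M => a • z) x w) = g.inner x v w

/-- `F` is `G`-invariant: `F ∘ λ_{g*} = F` for all `g`. -/
def FinslerMetric.Invariant (F : FinslerMetric E M) : Prop :=
  ∀ (a : G) (v : TangentBundle 𝓘(ℝ, E) M), F.F (tangentAction E a v) = F.F v

/-! ## Invariant metrizability -/

/-- There is an invariant Riemann metric with the same geodesics as `S`. -/
def Spray.InvRiemannMetrizable (S : Spray E M) : Prop :=
  ∃ g : RiemannMetric E M, RiemannInvariant G g ∧
    S.geodesics.Coincide (energyGeodesics (riemannEnergy g))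

/-- There is an invariant Riemann metric whose geodesics are projectively equivalent to those
of `S`. -/
def Spray.InvProjRiemannMetrizable (S : Spray E M) : Prop :=
  ∃ g : RiemannMetric E M, RiemannInvariant G g ∧
    S.geodesics.ProjEquiv (energyGeodesics (riemannEnergy g))

/-- There is an invariant Finsler metric with the same geodesics as `S`. -/
def Spray.InvFinslerMetrizable (S : Spray E M) : Prop :=
  ∃ F : FinslerMetric E M, F.Invariant G ∧
    S.geodesics.Coincide (energyGeodesics F.energy)

/-- There is an invariant Finsler metric whose geodesics are projectively equivalent to those
of `S`. -/
def Spray.InvProjFinslerMetrizable (S : Spray E M) : Prop :=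
  ∃ F : FinslerMetric E M, F.Invariant G ∧
    S.geodesics.ProjEquiv (energyGeodesics F.energy)

end Sprays

/-! ## Geodesic orbit sprays -/

section GeodesicOrbit

variable {EG : Type*} [NormedAddCommGroup EG] [NormedSpace ℝ EG]
  {G : Type*} [TopologicalSpace G] [ChartedSpace EG G] [Group G]
  {E : Type*} [NormedAddCommGroup E] [NormedSpace ℝ E]
  {M : Type*} [TopologicalSpace M] [ChartedSpace E M] [IsManifold 𝓘(ℝ, E) ∞ M]
  [MulAction G M]

variable (EG) in
/-- One-parameter subgroups of the Lie group `G`, i.e. the curves `t ↦ exp (t X)` with `X` in the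
Lie algebra: the smooth homomorphisms from `(ℝ, +)` to `G`. -/
def IsOneParameterSubgroup (a : ℝ → G) : Prop :=
  ContMDiff 𝓘(ℝ, ℝ) 𝓘(ℝ, EG) ∞ a ∧ ∀ s t, a (s + t) = a s * a t

variable (EG G) in
/-- A geodesic orbit spray on the homogeneous space `M` of `G` with origin `o`: it is `G`-invariant
and each of its geodesics emanating from `o` is homogeneous, i.e. the orbit of `o` under a
one-parameter subgroup. -/
def Spray.IsGeodesicOrbit (S : Spray E M) (o : M) : Prop :=
  S.Invariant G ∧
  ∀ (γ : ℝ → M) (I : Set ℝ), S.geodesics γ I → 0 ∈ I → γ 0 = o →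
    ∃ a : ℝ → G, IsOneParameterSubgroup EG a ∧ ∀ t ∈ I, γ t = a t • o

end GeodesicOrbit

end

/-!
The two notions of metrizability differ by a reparameterization `φ` of each geodesic, and the point
is that `φ` has to be affine. Let `L` be the energy of the invariant metric.

* Along the geodesics of the metric `L` is conserved
  (`IsEnergyFunction.conserves_energyGeodesics`): this follows from the Euler–Lagrange equation and
  Euler's identity for the function `L`, which is homogeneous of degree two.
* Along the geodesics of the spray `S` it is constant as well
  (`Spray.IsGeodesicOrbit.conserves`): such a geodesic is an orbit of a one-parameter subgroup up to
  a translation by an element of `G`, so all of its velocities are related by the action of `G`,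
  under which `L` is invariant.

Since the velocity of `γ ∘ φ` is `φ' γ̇`, and `L (φ' γ̇) = φ'² L (γ̇)`, the factor `φ'` is constant
(`CurveFamily.Coincide.of_projEquiv`). It remains to see that both families of geodesics are stable
under affine changes of the parameter. For the metric this is the homogeneity of `L` in the
Euler–Lagrange equation (`IsEnergyFunction.affineInvariant_energyGeodesics`). For the spray the
identity `[C, S] = S`, written in a chart, is an Euler equation for the components of `S` along each
ray `{k v | k > 0}`, whose solutions are homogeneous (`Spray.toFun_smul`,
`Spray.affineInvariant_geodesics`).

Riemann and Finsler metrics are treated together: only homogeneity, positivity and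
differentiability of the energy are used (`IsEnergyFunction`).
-/

/-! ### Velocities of curves -/

section Velocity

variable {E : Type*} [NormedAddCommGroup E] [NormedSpace ℝ E]
  {M : Type*} [TopologicalSpace M] [ChartedSpace E M]

theorem velocity_congr {γ γ' : ℝ → M} {t : ℝ} (h : γ =ᶠ[𝓝 t] γ') :
    velocity E γ t = velocity E γ' t := by
  have h1 := h.eq_of_nhds
  have h2 := h.mfderiv_eq (I := 𝓘(ℝ, ℝ)) (I' := 𝓘(ℝ, E))
  simp only [velocity]
  congr 1
  rw [h2]
  rfl

/-- At a point where `γ` is not differentiable the velocity is zero, by the convention on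
`mfderiv`. -/
theorem mdifferentiableAt_of_velocity_mem {γ : ℝ → M} {t : ℝ}
    (h : velocity E γ t ∈ slitTangentBundle E M) : MDifferentiableAt 𝓘(ℝ, ℝ) 𝓘(ℝ, E) γ t := by
  by_contra hn
  apply h
  simp only [velocity, mfderiv_zero_of_not_mdifferentiableAt hn]
  rfl

theorem velocity_comp_real {γ : ℝ → M} {φ : ℝ → ℝ} {t k : ℝ}
    (hγ : MDifferentiableAt 𝓘(ℝ, ℝ) 𝓘(ℝ, E) γ (φ t)) (hφ : HasDerivAt φ k t) :
    velocity E (γ ∘ φ) t = ⟨γ (φ t), k • (velocity E γ (φ t)).snd⟩ := by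
  have h1 := hγ.hasMFDerivAt.comp t hφ.hasFDerivAt.hasMFDerivAt
  simp only [velocity, h1.mfderiv]
  congr 1
  have : (ContinuousLinearMap.toSpanSingleton ℝ k) (1:ℝ) = k • (1:ℝ) := by simp
  erw [ContinuousLinearMap.comp_apply, this, map_smul]
  rfl

theorem velocity_comp_map {γ : ℝ → M} {f : M → M} {t : ℝ}
    (hγ : MDifferentiableAt 𝓘(ℝ, ℝ) 𝓘(ℝ, E) γ t)
    (hf : MDifferentiableAt 𝓘(ℝ, E) 𝓘(ℝ, E) f (γ t)) :
    velocity E (f ∘ γ) t = tangentMap 𝓘(ℝ, E) 𝓘(ℝ, E) f (velocity E γ t) := by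
  simp only [velocity, (hf.hasMFDerivAt.comp t hγ.hasMFDerivAt).mfderiv]
  rfl

theorem Real.hasDerivAt_affine (k d t : ℝ) : HasDerivAt (fun t => k * t + d) k t := by
  simpa using ((hasDerivAt_id t).const_mul k).add_const d

theorem velocity_affine {γ γ' : ℝ → M} {k d : ℝ} {I J : Set ℝ} (hI : IsOpenInterval I)
    (hv : ∀ t ∈ J, velocity E γ t ∈ slitTangentBundle E M)
    (h : ∀ t ∈ I, k * t + d ∈ J ∧ γ' t = γ (k * t + d)) {t : ℝ} (ht : t ∈ I) :
    velocity E γ' t = ⟨γ (k * t + d), k • (velocity E γ (k * t + d)).snd⟩ := by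
  have he : γ' =ᶠ[𝓝 t] γ ∘ fun t => k * t + d :=
    Filter.eventually_of_mem (hI.1.mem_nhds ht) fun s hs => (h s hs).2
  rw [velocity_congr he]
  exact velocity_comp_real (mdifferentiableAt_of_velocity_mem (hv _ (h t ht).1))
    (Real.hasDerivAt_affine k d t)

theorem smul_mem_slitTangentBundle {x : M} {y : TangentSpace 𝓘(ℝ, E) x} {k : ℝ} (hk : k ≠ 0)
    (hy : (⟨x, y⟩ : TangentBundle 𝓘(ℝ, E) M) ∈ slitTangentBundle E M) :
    (⟨x, k • y⟩ : TangentBundle 𝓘(ℝ, E) M) ∈ slitTangentBundle E M :=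
  smul_ne_zero hk hy

end Velocity

/-! ### Charts of the tangent bundle -/

section Charts

variable {E : Type*} [NormedAddCommGroup E] [NormedSpace ℝ E]
  {M : Type*} [TopologicalSpace M] [ChartedSpace E M] [IsManifold 𝓘(ℝ, E) ∞ M]

namespace TangentBundle

theorem extChartAt_tangent_apply (v w : TangentBundle 𝓘(ℝ, E) M) :
    extChartAt 𝓘(ℝ, E).tangent v w =
      (extChartAt 𝓘(ℝ, E) v.proj w.proj,
        tangentCoordChange 𝓘(ℝ, E) w.proj v.proj w.proj w.snd) := by
  rw [FiberBundle.extChartAt]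
  rfl

/-- The chart inverse maps each fibre `{a} × E` linearly to a tangent space. This holds for every
`p`, also off the target of the chart, where both sides take the same junk value. -/
theorem extChartAt_tangent_symm_apply (v : TangentBundle 𝓘(ℝ, E) M) (p : E × E) :
    (extChartAt 𝓘(ℝ, E).tangent v).symm p =
      ⟨(extChartAt 𝓘(ℝ, E) v.proj).symm p.1,
        tangentCoordChange 𝓘(ℝ, E) v.proj ((extChartAt 𝓘(ℝ, E) v.proj).symm p.1)
          ((extChartAt 𝓘(ℝ, E) v.proj).symm p.1) p.2⟩ := by
  rw [FiberBundle.extChartAt]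
  rfl

theorem extChartAt_tangent_target (v : TangentBundle 𝓘(ℝ, E) M) :
    (extChartAt 𝓘(ℝ, E).tangent v).target = (extChartAt 𝓘(ℝ, E) v.proj).target ×ˢ univ := by
  rw [FiberBundle.extChartAt_target]
  ext ⟨x, y⟩
  simp only [mem_inter_iff, mem_prod, mem_univ, and_true, mem_preimage, and_iff_left_iff_imp]
  intro hx
  simpa using (extChartAt 𝓘(ℝ, E) v.proj).map_target hx

theorem mem_extChartAt_tangent_source {v w : TangentBundle 𝓘(ℝ, E) M} :
    w ∈ (extChartAt 𝓘(ℝ, E).tangent v).source ↔ w.proj ∈ (chartAt E v.proj).source := by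
  rw [extChartAt_source, TangentBundle.mem_chart_source_iff]

/-- The preferred chart of `TM` at `v` depends only on the base point of `v`, so that a single chart
serves for a whole ray `{k v | k > 0}`. -/
theorem extChartAt_tangent_eq_of_proj_eq {v w : TangentBundle 𝓘(ℝ, E) M} (h : v.proj = w.proj) :
    extChartAt 𝓘(ℝ, E).tangent v = extChartAt 𝓘(ℝ, E).tangent w := by
  rw [FiberBundle.extChartAt, FiberBundle.extChartAt, h]

theorem extChartAt_tangent_self (v w : TangentBundle 𝓘(ℝ, E) M) (h : w.proj = v.proj) :
    extChartAt 𝓘(ℝ, E).tangent v w = (extChartAt 𝓘(ℝ, E) v.proj v.proj, w.snd) := by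
  obtain ⟨x, y⟩ := v
  obtain ⟨x', z⟩ := w
  obtain rfl : x' = x := h
  rw [extChartAt_tangent_apply]
  exact Prod.ext rfl (tangentCoordChange_self (mem_extChartAt_source x'))

end TangentBundle

theorem hasDerivAt_extChartAt_comp {x : M} {γ : ℝ → M} {t : ℝ}
    (hγ : MDifferentiableAt 𝓘(ℝ, ℝ) 𝓘(ℝ, E) γ t) (ht : γ t ∈ (chartAt E x).source) :
    HasDerivAt (extChartAt 𝓘(ℝ, E) x ∘ γ)
      (tangentCoordChange 𝓘(ℝ, E) (γ t) x (γ t) (velocity E γ t).snd) t := by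
  have h1 := (mdifferentiableAt_extChartAt (I := 𝓘(ℝ, E)) ht).hasMFDerivAt.comp t hγ.hasMFDerivAt
  have h2 : HasDerivAt (extChartAt 𝓘(ℝ, E) x ∘ γ) _ t :=
    HasFDerivAt.hasDerivAt (F := E) (hasMFDerivAt_iff_hasFDerivAt.1 h1)
  have := mfderiv_chartAt_eq_tangentCoordChange (I := 𝓘(ℝ, E)) ht
  convert h2 using 1
  have h3 : (extChartAt 𝓘(ℝ, E) x : M → E) = chartAt E x := by simp
  rw [h3, ← this]
  rfl

/-- In the coordinates `(x, y)` of `TM` the velocity of `γ` is `(x(t), x'(t))`. -/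
theorem extChartAt_tangent_velocity (v : TangentBundle 𝓘(ℝ, E) M) {γ : ℝ → M} {t : ℝ}
    (hγ : MDifferentiableAt 𝓘(ℝ, ℝ) 𝓘(ℝ, E) γ t) (ht : γ t ∈ (chartAt E v.proj).source) :
    extChartAt 𝓘(ℝ, E).tangent v (velocity E γ t) =
      ((extChartAt 𝓘(ℝ, E) v.proj ∘ γ) t, deriv (extChartAt 𝓘(ℝ, E) v.proj ∘ γ) t) := by
  rw [(hasDerivAt_extChartAt_comp hγ ht).deriv, TangentBundle.extChartAt_tangent_apply]
  rfl

end Charts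

/-! ### Conservation of energy and constant-speed reparameterizations -/

theorem CurveFamily.Coincide.projEquiv {M : Type*} {A B : CurveFamily M}
    (hA : ∀ γ I, A γ I → IsOpenInterval I) (h : A.Coincide B) : A.ProjEquiv B := by
  have hid : ∀ I, IsOpenInterval I → IsReparam id I I := fun I hI =>
    ⟨hI, image_id I, contDiff_id.contDiffOn, fun t _ => by simp⟩
  exact ⟨fun γ I hγ => ⟨id, I, hid I (hA γ I hγ), (h γ I).1 hγ⟩,
    fun γ I hγ => ⟨id, I, hid I (hA γ I ((h γ I).2 hγ)), (h γ I).2 hγ⟩⟩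

section Energy

variable {E : Type*} [NormedAddCommGroup E] [NormedSpace ℝ E]
  {M : Type*} [TopologicalSpace M] [ChartedSpace E M] [IsManifold 𝓘(ℝ, E) ∞ M]

/-- The properties shared by the energies of Riemann and Finsler metrics that matter for their
extremals: differentiable and positive off the zero section, and positively homogeneous of degree
two in the fibres. Nondegeneracy of the fibre Hessian is not required. -/
structure IsEnergyFunction (L : TangentBundle 𝓘(ℝ, E) M → ℝ) : Prop where
  mdifferentiableAt : ∀ v ∈ slitTangentBundle E M,
    MDifferentiableAt 𝓘(ℝ, E).tangent 𝓘(ℝ, ℝ) L v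
  smul : ∀ (x : M) (y : TangentSpace 𝓘(ℝ, E) x) (c : ℝ), 0 < c → L ⟨x, c • y⟩ = c ^ 2 * L ⟨x, y⟩
  pos : ∀ v ∈ slitTangentBundle E M, 0 < L v

namespace IsEnergyFunction

variable {L : TangentBundle 𝓘(ℝ, E) M → ℝ}

theorem differentiableAt_chart (hL : IsEnergyFunction L) (v : TangentBundle 𝓘(ℝ, E) M)
    {w : TangentBundle 𝓘(ℝ, E) M}
    (hw : w ∈ slitTangentBundle E M) (h : w.proj ∈ (chartAt E v.proj).source) :
    DifferentiableAt ℝ (fun p : E × E => L ((extChartAt 𝓘(ℝ, E).tangent v).symm p))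
      (extChartAt 𝓘(ℝ, E).tangent v w) := by
  have hs : w ∈ (extChartAt 𝓘(ℝ, E).tangent v).source :=
    TangentBundle.mem_extChartAt_tangent_source.2 h
  have h1 : MDifferentiableAt 𝓘(ℝ, E × E) 𝓘(ℝ, E).tangent (extChartAt 𝓘(ℝ, E).tangent v).symm
      (extChartAt 𝓘(ℝ, E).tangent v w) := by
    have := mdifferentiableWithinAt_extChartAt_symm (I := 𝓘(ℝ, E).tangent)
      ((extChartAt 𝓘(ℝ, E).tangent v).map_source hs)
    rwa [ModelWithCorners.range_eq_univ, mdifferentiableWithinAt_univ] at this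
  have h2 : MDifferentiableAt 𝓘(ℝ, E).tangent 𝓘(ℝ, ℝ) L
      ((extChartAt 𝓘(ℝ, E).tangent v).symm (extChartAt 𝓘(ℝ, E).tangent v w)) := by
    rw [(extChartAt 𝓘(ℝ, E).tangent v).left_inv hs]
    exact hL.mdifferentiableAt w hw
  exact (h2.comp _ h1).differentiableAt

theorem chart_smul (hL : IsEnergyFunction L) (v : TangentBundle 𝓘(ℝ, E) M) (x y : E) {k : ℝ}
    (hk : 0 < k) :
    L ((extChartAt 𝓘(ℝ, E).tangent v).symm (x, k • y)) =
      k ^ 2 * L ((extChartAt 𝓘(ℝ, E).tangent v).symm (x, y)) := by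
  rw [TangentBundle.extChartAt_tangent_symm_apply, TangentBundle.extChartAt_tangent_symm_apply,
    map_smul]
  exact hL.smul _ _ k hk

/-- Euler's identity `y · ∂L/∂y = 2 L` in a chart. -/
theorem fderiv_fiber_self (hL : IsEnergyFunction L) (v : TangentBundle 𝓘(ℝ, E) M)
    {w : TangentBundle 𝓘(ℝ, E) M}
    (hw : w ∈ slitTangentBundle E M) (h : w.proj ∈ (chartAt E v.proj).source) :
    fderiv ℝ (fun y => L ((extChartAt 𝓘(ℝ, E).tangent v).symm
      ((extChartAt 𝓘(ℝ, E).tangent v w).1, y))) (extChartAt 𝓘(ℝ, E).tangent v w).2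
      (extChartAt 𝓘(ℝ, E).tangent v w).2 = 2 * L w := by
  have hs : w ∈ (extChartAt 𝓘(ℝ, E).tangent v).source :=
    TangentBundle.mem_extChartAt_tangent_source.2 h
  have hd := hL.differentiableAt_chart v hw h
  have hLw : L w = L ((extChartAt 𝓘(ℝ, E).tangent v).symm (extChartAt 𝓘(ℝ, E).tangent v w)) := by
    rw [(extChartAt 𝓘(ℝ, E).tangent v).left_inv hs]
  rw [hLw]
  revert hd
  generalize extChartAt 𝓘(ℝ, E).tangent v w = p
  intro hd
  obtain ⟨x, y⟩ := p
  have hd' : DifferentiableAt ℝ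
      (fun y => L ((extChartAt 𝓘(ℝ, E).tangent v).symm (x, y))) y :=
    DifferentiableAt.comp (f := fun z : E => (x, z)) y hd (by fun_prop)
  have h1 : HasDerivAt (fun k : ℝ => L ((extChartAt 𝓘(ℝ, E).tangent v).symm (x, k • y)))
      (fderiv ℝ (fun y => L ((extChartAt 𝓘(ℝ, E).tangent v).symm (x, y))) y y) 1 := by
    have hk : HasDerivAt (fun k : ℝ => k • y) y 1 := by
      simpa using (hasDerivAt_id (1 : ℝ)).smul_const y
    have hf : HasFDerivAt (fun y => L ((extChartAt 𝓘(ℝ, E).tangent v).symm (x, y)))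
      (fderiv ℝ (fun y => L ((extChartAt 𝓘(ℝ, E).tangent v).symm (x, y))) y) ((1 : ℝ) • y) := by
      rw [one_smul]; exact hd'.hasFDerivAt
    exact hf.comp_hasDerivAt (1 : ℝ) hk
  have h2 : HasDerivAt (fun k : ℝ => k ^ 2 * L ((extChartAt 𝓘(ℝ, E).tangent v).symm (x, y)))
      (2 * L ((extChartAt 𝓘(ℝ, E).tangent v).symm (x, y))) 1 := by
    simpa using (hasDerivAt_pow 2 (1 : ℝ)).mul_const
      (L ((extChartAt 𝓘(ℝ, E).tangent v).symm (x, y)))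
  refine h1.unique (h2.congr_of_eventuallyEq ?_)
  filter_upwards [lt_mem_nhds one_pos] with k hk
  exact hL.chart_smul v x y hk

/-- The energy is conserved along extremals. Differentiating Euler's identity `2 L = p · y`, with
`p = ∂L/∂y`, and using `p' = ∂L/∂x` gives `2 L' = ∂L/∂x · y + ∂L/∂y · y' = L'`. -/
theorem hasDerivAt_zero_of_eulerLagrangeAt (hL : IsEnergyFunction L) {γ : ℝ → M} {t₀ : ℝ}
    (hγ : ContMDiffAt 𝓘(ℝ, ℝ) 𝓘(ℝ, E) 2 γ t₀)
    (hv : ∀ᶠ t in 𝓝 t₀, velocity E γ t ∈ slitTangentBundle E M)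
    (h : EulerLagrangeAt L γ t₀) :
    HasDerivAt (fun t => L (velocity E γ t)) 0 t₀ := by
  set v := velocity E γ t₀ with hvdef
  set x : ℝ → E := extChartAt 𝓘(ℝ, E) (γ t₀) ∘ γ with hx
  set c : ℝ → E × E := fun t => extChartAt 𝓘(ℝ, E).tangent v (velocity E γ t) with hc
  set l : E × E → ℝ := fun p => L ((extChartAt 𝓘(ℝ, E).tangent v).symm p) with hl
  have hsrc : ∀ᶠ t in 𝓝 t₀, γ t ∈ (chartAt E (γ t₀)).source :=
    hγ.continuousAt.eventually ((chartAt E (γ t₀)).open_source.mem_nhds (mem_chart_source E _))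
  have hxC : ContDiffAt ℝ 2 x t₀ :=
    ((contMDiffAt_extChartAt (I := 𝓘(ℝ, E))).comp t₀ hγ).contDiffAt
  have hcx : c =ᶠ[𝓝 t₀] fun t => (x t, deriv x t) := by
    filter_upwards [hsrc, hv] with t h1 h2
    exact extChartAt_tangent_velocity v (mdifferentiableAt_of_velocity_mem h2) h1
  have hx1 : HasDerivAt x (deriv x t₀) t₀ :=
    (hxC.differentiableAt (by norm_num)).hasDerivAt
  have hx2 : HasDerivAt (deriv x) (deriv (deriv x) t₀) t₀ :=
    by
    have h1 : ContDiffAt ℝ 1 (fderiv ℝ x) t₀ := hxC.fderiv_right (by norm_num)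
    have h2 : DifferentiableAt ℝ (deriv x) t₀ :=
      (h1.differentiableAt (by norm_num)).clm_apply (differentiableAt_const (1 : ℝ))
    exact h2.hasDerivAt
  have hcd : HasDerivAt c (deriv x t₀, deriv (deriv x) t₀) t₀ :=
    (hx1.prodMk hx2).congr_of_eventuallyEq hcx
  have hc2 : HasDerivAt (fun t => (c t).2) (deriv (deriv x) t₀) t₀ := hcd.snd
  have hc0 : (c t₀).2 = deriv x t₀ := by rw [hcx.eq_of_nhds]
  -- the preferred chart at the velocity is the one used in `EulerLagrangeAt`
  have hEL : HasDerivAt (fun t => fderiv ℝ (fun y => l ((c t).1, y)) (c t).2)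
    (fderiv ℝ (fun x => l (x, (c t₀).2)) (c t₀).1) t₀ := h
  have hld : DifferentiableAt ℝ l (c t₀) :=
    hL.differentiableAt_chart v hv.self_of_nhds (mem_chart_source E _)
  have hpar : fderiv ℝ l (c t₀) (deriv x t₀, deriv (deriv x) t₀) =
      fderiv ℝ (fun x => l (x, (c t₀).2)) (c t₀).1 (deriv x t₀) +
      fderiv ℝ (fun y => l ((c t₀).1, y)) (c t₀).2 (deriv (deriv x) t₀) := by
    have e1 : HasFDerivAt (fun x => l (x, (c t₀).2)) _ (c t₀).1 :=
      HasFDerivAt.comp (f := fun z : E => (z, (c t₀).2)) (c t₀).1 hld.hasFDerivAt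
        (hasFDerivAt_prodMk_left _ _)
    have e2 : HasFDerivAt (fun y => l ((c t₀).1, y)) _ (c t₀).2 :=
      HasFDerivAt.comp (f := fun z : E => ((c t₀).1, z)) (c t₀).2 hld.hasFDerivAt
        (hasFDerivAt_prodMk_right _ _)
    rw [e1.fderiv, e2.fderiv]
    simp [← map_add]
  have hLl : (fun t => L (velocity E γ t)) =ᶠ[𝓝 t₀] l ∘ c := by
    filter_upwards [hsrc] with t h1
    exact congrArg L ((extChartAt 𝓘(ℝ, E).tangent v).left_inv
      (TangentBundle.mem_extChartAt_tangent_source (w := velocity E γ t).2 h1)).symm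
  have hD := (hld.hasFDerivAt.comp_hasDerivAt t₀ hcd).congr_of_eventuallyEq hLl
  have h2L : HasDerivAt (fun t => 2 * L (velocity E γ t)) _ t₀ :=
    (hEL.clm_apply hc2).congr_of_eventuallyEq (by
      filter_upwards [hsrc, hv] with t h1 h2
      exact (hL.fderiv_fiber_self v h2 h1).symm)
  have key := h2L.unique (hD.const_mul 2)
  rw [hpar, hc0] at key
  rw [hpar, hc0] at hD
  have hzero : ∀ a : ℝ, a = 2 * a → a = 0 := fun a ha => by linarith
  rwa [hzero _ key] at hD

end IsEnergyFunction

theorem IsOpenInterval.eq_of_hasDerivAt_zero {I : Set ℝ} (hI : IsOpenInterval I) {f : ℝ → ℝ}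
    (hf : ∀ t ∈ I, HasDerivAt f 0 t) {s t : ℝ} (hs : s ∈ I) (ht : t ∈ I) : f s = f t :=
  hI.1.is_const_of_deriv_eq_zero hI.2.1.isPreconnected
    (fun t ht => (hf t ht).differentiableAt.differentiableWithinAt)
    (fun t ht => (hf t ht).deriv) hs ht

/-- `L` is constant along the velocity of each curve of the family. -/
def CurveFamily.Conserves (A : CurveFamily M) (L : TangentBundle 𝓘(ℝ, E) M → ℝ) : Prop :=
  ∀ γ I, A γ I → ∀ s ∈ I, ∀ t ∈ I, L (velocity E γ s) = L (velocity E γ t)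

theorem IsEnergyFunction.conserves_energyGeodesics {L : TangentBundle 𝓘(ℝ, E) M → ℝ}
    (hL : IsEnergyFunction L) : CurveFamily.Conserves (energyGeodesics L) L := by
  rintro γ I ⟨hI, hγ, hv, hEL⟩ s hs t ht
  refine hI.eq_of_hasDerivAt_zero (f := fun t => L (velocity E γ t)) (fun r hr => ?_) hs ht
  exact hL.hasDerivAt_zero_of_eulerLagrangeAt (hγ.contMDiffAt (hI.1.mem_nhds hr))
    (Filter.eventually_of_mem (hI.1.mem_nhds hr) hv) (hEL r hr)

/-- The family is stable under orientation preserving affine changes of the parameter, and under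
restriction to subintervals. The new curve `γ'` needs to agree with `γ (k t + d)` on `I` only,
because the values of a curve outside of its interval carry no meaning. -/
def CurveFamily.AffineInvariant (A : CurveFamily M) : Prop :=
  ∀ γ J, A γ J → ∀ (k d : ℝ), 0 < k → ∀ (γ' : ℝ → M) (I : Set ℝ), IsOpenInterval I →
    (∀ t ∈ I, k * t + d ∈ J ∧ γ' t = γ (k * t + d)) → A γ' I

/-- Two projectively equivalent families of regular curves which both have constant energy coincide:
`L (γ ∘ φ)˙ = φ'² L (γ̇ ∘ φ)` forces `φ'` to be constant, so the reparameterization is affine. -/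
theorem CurveFamily.Coincide.of_projEquiv {A B : CurveFamily M}
    {L : TangentBundle 𝓘(ℝ, E) M → ℝ} (hL : IsEnergyFunction L)
    (hA : ∀ γ I, A γ I → IsOpenInterval I ∧ ∀ t ∈ I, velocity E γ t ∈ slitTangentBundle E M)
    (hB : ∀ γ I, B γ I → IsOpenInterval I ∧ ∀ t ∈ I, velocity E γ t ∈ slitTangentBundle E M)
    (hAL : A.Conserves L) (hBL : B.Conserves L)
    (hAaff : A.AffineInvariant) (hBaff : B.AffineInvariant) (h : A.ProjEquiv B) :
    A.Coincide B := by
  have main : ∀ {A B : CurveFamily M},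
      (∀ γ I, A γ I → IsOpenInterval I ∧ ∀ t ∈ I, velocity E γ t ∈ slitTangentBundle E M) →
      A.Conserves L → B.Conserves L → B.AffineInvariant →
      (∀ γ I, A γ I → ∃ φ J, IsReparam φ J I ∧ B (γ ∘ φ) J) → ∀ γ I, A γ I → B γ I := by
    intro A B hA hAL hBL hBaff h γ I hγ
    obtain ⟨φ, J, ⟨hJ, rfl, hφ, hpos⟩, hB⟩ := h γ I hγ
    obtain ⟨hI, hv⟩ := hA γ _ hγ
    have hd : ∀ t ∈ J, HasDerivAt φ (deriv φ t) t := fun t ht =>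
      ((hφ.contDiffAt (hJ.1.mem_nhds ht)).differentiableAt (by simp)).hasDerivAt
    have hvel : ∀ t ∈ J, L (velocity E (γ ∘ φ) t) =
        deriv φ t ^ 2 * L (velocity E γ (φ t)) := fun t ht => by
      rw [velocity_comp_real (mdifferentiableAt_of_velocity_mem (hv _ (mem_image_of_mem φ ht)))
        (hd t ht)]
      exact hL.smul _ _ _ (hpos t ht)
    obtain ⟨t₀, ht₀⟩ := hJ.2.2
    set k := deriv φ t₀ with hk
    have hk0 : 0 < k := hpos t₀ ht₀
    -- both energies are constant, hence so is the ratio `φ'²`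
    have hconst : ∀ t ∈ J, deriv φ t = k := fun t ht => by
      have h1 := hBL _ _ hB t ht t₀ ht₀
      rw [hvel t ht, hvel t₀ ht₀,
        hAL γ _ hγ _ (mem_image_of_mem φ ht) _ (mem_image_of_mem φ ht₀)] at h1
      have h2 := mul_right_cancel₀ (hL.pos _ (hv _ (mem_image_of_mem φ ht₀))).ne' h1
      exact (pow_left_inj₀ (hpos t ht).le hk0.le two_ne_zero).1 h2
    have haff : ∀ t ∈ J, φ t = k * t + (φ t₀ - k * t₀) := fun t ht => by
      have := hJ.eq_of_hasDerivAt_zero (f := fun s => φ s - k * s) (fun s hs => by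
        have := (hd s hs).fun_sub ((hasDerivAt_id s).const_mul k)
        simpa [hconst s hs] using this) ht ht₀
      linarith
    refine hBaff _ J hB k⁻¹ (-k⁻¹ * (φ t₀ - k * t₀)) (inv_pos.2 hk0) γ _ hI ?_
    rintro _ ⟨t, ht, rfl⟩
    have : k⁻¹ * φ t + -k⁻¹ * (φ t₀ - k * t₀) = t := by
      rw [haff t ht]
      field_simp
      ring
    rw [this]
    exact ⟨ht, rfl⟩
  exact fun γ I => ⟨main hA hAL hBL hBaff h.1 γ I, main hB hBL hAL hAaff h.2 γ I⟩

end Energy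

/-! ### Rescaling solutions of the Euler–Lagrange equation -/

section Rescaling

variable {E : Type*} [NormedAddCommGroup E] [NormedSpace ℝ E]
  {M : Type*} [TopologicalSpace M] [ChartedSpace E M] [IsManifold 𝓘(ℝ, E) ∞ M]

theorem TangentBundle.extChartAt_tangent_smul (v : TangentBundle 𝓘(ℝ, E) M) (x : M)
    (y : TangentSpace 𝓘(ℝ, E) x) (k : ℝ) :
    extChartAt 𝓘(ℝ, E).tangent v (⟨x, k • y⟩ : TangentBundle 𝓘(ℝ, E) M) =
      ((extChartAt 𝓘(ℝ, E).tangent v ⟨x, y⟩).1,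
        k • (extChartAt 𝓘(ℝ, E).tangent v ⟨x, y⟩).2) := by
  rw [extChartAt_tangent_apply, extChartAt_tangent_apply]
  exact Prod.ext rfl (map_smul _ _ _)

theorem fderiv_smul_of_sq_homogeneous {f : E → ℝ} {k : ℝ} (hk : k ≠ 0)
    (hf : ∀ y, f (k • y) = k ^ 2 * f y) (y : E) : fderiv ℝ f (k • y) = k • fderiv ℝ f y := by
  have h1 := fderiv_comp_smul (𝕜 := ℝ) (f := f) (x := y) k
  have h2 : (fun y => f (k • y)) = k ^ 2 • f := by
    ext y
    simp [hf]
  rw [h2, fderiv_const_smul_field] at h1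
  have h3 := congrArg (k⁻¹ • ·) h1
  simp only [smul_smul, inv_mul_cancel₀ hk, one_smul] at h3
  rw [← h3, Pi.smul_apply, smul_smul]
  congr 1
  field_simp

theorem IsEnergyFunction.affineInvariant_energyGeodesics {L : TangentBundle 𝓘(ℝ, E) M → ℝ}
    (hL : IsEnergyFunction L) : (energyGeodesics L).AffineInvariant := by
  rintro γ J ⟨hJ, hγ, hv, hEL⟩ k d hk γ' I hI h
  have hvel := fun t (ht : t ∈ I) => velocity_affine (E := E) hI hv h ht
  refine ⟨hI, ?_, fun t ht => ?_, fun t₀ ht₀ => ?_⟩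
  · refine (hγ.comp (f := fun t : ℝ => k * t + d) (s := I) ?_ fun t ht => (h t ht).1).congr
      fun t ht => (h t ht).2
    exact ContMDiff.contMDiffOn (ContDiff.contMDiff (by fun_prop))
  · rw [hvel t ht]
    exact smul_mem_slitTangentBundle hk.ne' (hv _ (h t ht).1)
  · set v := velocity E γ (k * t₀ + d) with hvdef
    have hproj : (velocity E γ' t₀).proj = v.proj := (h t₀ ht₀).2
    have hEL₀ := hEL _ (h t₀ ht₀).1
    simp only [EulerLagrangeAt] at hEL₀ ⊢
    rw [TangentBundle.extChartAt_tangent_eq_of_proj_eq hproj]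
    rw [← hvdef] at hEL₀
    set l : E × E → ℝ := fun p => L ((extChartAt 𝓘(ℝ, E).tangent v).symm p) with hl
    set c : ℝ → E × E := fun t => extChartAt 𝓘(ℝ, E).tangent v (velocity E γ t) with hc
    have hc' : ∀ t ∈ I, extChartAt 𝓘(ℝ, E).tangent v (velocity E γ' t) =
        ((c (k * t + d)).1, k • (c (k * t + d)).2) := fun t ht => by
      rw [hvel t ht]
      exact TangentBundle.extChartAt_tangent_smul v _ (velocity E γ (k * t + d)).snd k
    rw [hc' t₀ ht₀]
    have h1 := (hEL₀.scomp t₀ (Real.hasDerivAt_affine k d t₀)).const_smul k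
    have h2 : fderiv ℝ (fun x => l (x, k • (c (k * t₀ + d)).2)) (c (k * t₀ + d)).1 =
        k • k • fderiv ℝ (fun x => l (x, (c (k * t₀ + d)).2)) (c (k * t₀ + d)).1 := by
      have h3 : (fun x => l (x, k • (c (k * t₀ + d)).2)) =
          k ^ 2 • fun x => l (x, (c (k * t₀ + d)).2) :=
        funext fun x => hL.chart_smul v x _ hk
      rw [h3, fderiv_const_smul_field, Pi.smul_apply, sq, mul_smul]
    change HasDerivAt _ (fderiv ℝ (fun x => l (x, k • (c (k * t₀ + d)).2)) (c (k * t₀ + d)).1) t₀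
    rw [h2]
    refine h1.congr_of_eventuallyEq ?_
    filter_upwards [hI.1.mem_nhds ht₀] with t ht
    rw [hc' t ht]
    exact fderiv_smul_of_sq_homogeneous hk.ne' (fun y => hL.chart_smul v _ y hk) _

end Rescaling

/-! ### Homogeneity of a spray from `[C, S] = S` -/

section SprayHomogeneity

/-- Euler's theorem along a ray: a solution of `r f' = n f` on `r > 0` is homogeneous of degree
`n`. -/
theorem eq_pow_smul_of_euler {F : Type*} [NormedAddCommGroup F] [NormedSpace ℝ F] {f : ℝ → F}
    {n : ℕ} (h : ∀ r, 0 < r → ∃ w, HasDerivAt f w r ∧ r • w = (n : ℝ) • f r) {k : ℝ}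
    (hk : 0 < k) : f k = k ^ n • f 1 := by
  have hd : ∀ r, 0 < r → HasDerivAt (fun r : ℝ => r ^ (-n : ℤ) • f r) 0 r := fun r hr => by
    obtain ⟨w, hw, hrw⟩ := h r hr
    have h1 := (hasDerivAt_zpow (-n : ℤ) r (Or.inl hr.ne')).smul hw
    refine h1.congr_deriv ?_
    have hw' : w = r⁻¹ • (n : ℝ) • f r := by rw [← hrw, inv_smul_smul₀ hr.ne']
    rw [hw', smul_smul, smul_smul, ← add_smul, zpow_sub_one₀ hr.ne']
    push_cast
    ring_nf
    simp
  have h1 := isOpen_Ioi.is_const_of_deriv_eq_zero (isPreconnected_Ioi (a := (0 : ℝ)))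
    (fun r hr => (hd r hr).differentiableAt.differentiableWithinAt)
    (fun r hr => (hd r hr).deriv) hk (mem_Ioi.2 one_pos)
  simp only [zpow_neg, zpow_natCast, one_pow, inv_one, one_smul] at h1
  rwa [inv_smul_eq_iff₀ (pow_ne_zero n hk.ne')] at h1

variable {E : Type*} [NormedAddCommGroup E] [NormedSpace ℝ E]
  {M : Type*} [TopologicalSpace M] [ChartedSpace E M] [IsManifold 𝓘(ℝ, E) ∞ M]

/-- The expression of a vector field `W` on `TM` in the preferred chart of `TM` at `v`. -/
noncomputable def chartField (v : TangentBundle 𝓘(ℝ, E) M)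
    (W : (w : TangentBundle 𝓘(ℝ, E) M) → TangentSpace 𝓘(ℝ, E).tangent w) : E × E → E × E :=
  VectorField.mpullbackWithin 𝓘(ℝ, E × E) 𝓘(ℝ, E).tangent (extChartAt 𝓘(ℝ, E).tangent v).symm W
    (range 𝓘(ℝ, E).tangent)

/-- At the centre `v` of the chart the coordinate expression is `W v` itself, because the tangent
space at `v` is modelled on that same chart. -/
theorem chartField_self (v : TangentBundle 𝓘(ℝ, E) M)
    (W : (w : TangentBundle 𝓘(ℝ, E) M) → TangentSpace 𝓘(ℝ, E).tangent w) :
    chartField v W (extChartAt 𝓘(ℝ, E).tangent v v) = W v := by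
  have hv : (extChartAt 𝓘(ℝ, E).tangent v).symm (extChartAt 𝓘(ℝ, E).tangent v v) = v :=
    extChartAt_to_inv v
  have hW : (W ((extChartAt 𝓘(ℝ, E).tangent v).symm (extChartAt 𝓘(ℝ, E).tangent v v)) : E × E) =
      W v := congrArg (fun w => (W w : E × E)) hv
  have h := mfderivWithin_extChartAt_symm_inverse_apply (I := 𝓘(ℝ, E).tangent) (x := v) (W v)
  rw [chartField, VectorField.mpullbackWithin_apply]
  refine Eq.trans ?_ h
  exact congrArg (fun ξ : E × E => (mfderivWithin 𝓘(ℝ, E × E) 𝓘(ℝ, E).tangent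
    (extChartAt 𝓘(ℝ, E).tangent v).symm (range 𝓘(ℝ, E).tangent)
    (extChartAt 𝓘(ℝ, E).tangent v v)).inverse ξ) hW

theorem chartField_eq_of_proj_eq {v w : TangentBundle 𝓘(ℝ, E) M} (h : v.proj = w.proj)
    (W : (w : TangentBundle 𝓘(ℝ, E) M) → TangentSpace 𝓘(ℝ, E).tangent w) :
    chartField v W = chartField w W := by
  rw [chartField, chartField, TangentBundle.extChartAt_tangent_eq_of_proj_eq h]

theorem mdifferentiableAt_fiberInclusion (x : M) (y : E) :
    MDifferentiableAt 𝓘(ℝ, E) 𝓘(ℝ, E).tangent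
      (fun z : E => (⟨x, z⟩ : TangentBundle 𝓘(ℝ, E) M)) y := by
  set v : TangentBundle 𝓘(ℝ, E) M := ⟨x, 0⟩
  have h : (fun z : E => (⟨x, z⟩ : TangentBundle 𝓘(ℝ, E) M)) =
      fun z : E => (extChartAt 𝓘(ℝ, E).tangent v).symm (extChartAt 𝓘(ℝ, E) x x, z) := by
    ext1 z
    have := TangentBundle.extChartAt_tangent_self v ⟨x, z⟩ rfl
    refine Eq.trans ?_ (congrArg (extChartAt 𝓘(ℝ, E).tangent v).symm this)
    rw [(extChartAt 𝓘(ℝ, E).tangent v).left_inv]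
    exact TangentBundle.mem_extChartAt_tangent_source.2 (mem_chart_source E x)
  rw [h]
  have ht : (extChartAt 𝓘(ℝ, E) x x, y) ∈ (extChartAt 𝓘(ℝ, E).tangent v).target := by
    rw [TangentBundle.extChartAt_tangent_target]
    exact ⟨mem_extChartAt_target x, mem_univ _⟩
  have h1 := mdifferentiableWithinAt_extChartAt_symm (I := 𝓘(ℝ, E).tangent) ht
  rw [ModelWithCorners.range_eq_univ, mdifferentiableWithinAt_univ] at h1
  refine MDifferentiableAt.comp (I' := 𝓘(ℝ, E × E)) (f := fun z : E => (extChartAt 𝓘(ℝ, E) x x, z))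
    y h1 ?_
  exact DifferentiableAt.mdifferentiableAt (by fun_prop)

/-- In coordinates `(x, y)` the Liouville field is `(0, y)`. -/
theorem mfderivWithin_extChartAt_symm_vertical (v : TangentBundle 𝓘(ℝ, E) M) {p : E × E}
    (hp : p ∈ (extChartAt 𝓘(ℝ, E).tangent v).target) :
    mfderivWithin 𝓘(ℝ, E × E) 𝓘(ℝ, E).tangent (extChartAt 𝓘(ℝ, E).tangent v).symm
      (range 𝓘(ℝ, E).tangent) p ((0, p.2) : E × E) =
    liouvilleField E M ((extChartAt 𝓘(ℝ, E).tangent v).symm p) := by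
  obtain ⟨a, y⟩ := p
  have h1 := mdifferentiableWithinAt_extChartAt_symm (I := 𝓘(ℝ, E).tangent) hp
  rw [ModelWithCorners.range_eq_univ, mdifferentiableWithinAt_univ] at h1
  rw [ModelWithCorners.range_eq_univ, mfderivWithin_univ]
  set x := (extChartAt 𝓘(ℝ, E) v.proj).symm a with hx
  set A : E →L[ℝ] E := tangentCoordChange 𝓘(ℝ, E) v.proj x x with hA
  have hsymm : ∀ z : E, (extChartAt 𝓘(ℝ, E).tangent v).symm (a, z) = ⟨x, A z⟩ := fun z =>
    TangentBundle.extChartAt_tangent_symm_apply v (a, z)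
  have e1 : HasMFDerivAt 𝓘(ℝ, E) 𝓘(ℝ, E).tangent
      (fun z : E => (extChartAt 𝓘(ℝ, E).tangent v).symm (a, z)) y
      ((mfderiv 𝓘(ℝ, E × E) 𝓘(ℝ, E).tangent (extChartAt 𝓘(ℝ, E).tangent v).symm (a, y)).comp
        (ContinuousLinearMap.inr ℝ E E)) :=
    HasMFDerivAt.comp (I' := 𝓘(ℝ, E × E)) (f := fun z : E => (a, z)) y h1.hasMFDerivAt
      (hasFDerivAt_prodMk_right a y).hasMFDerivAt
  have e2 : HasMFDerivAt 𝓘(ℝ, E) 𝓘(ℝ, E).tangent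
      (fun z : E => (⟨x, A z⟩ : TangentBundle 𝓘(ℝ, E) M)) y
      ((mfderiv 𝓘(ℝ, E) 𝓘(ℝ, E).tangent
        (fun z : E => (⟨x, z⟩ : TangentBundle 𝓘(ℝ, E) M)) (A y)).comp A) :=
    HasMFDerivAt.comp (I' := 𝓘(ℝ, E)) (f := A) y
      (mdifferentiableAt_fiberInclusion x (A y)).hasMFDerivAt A.hasFDerivAt.hasMFDerivAt
  have e3 : (fun z : E => (extChartAt 𝓘(ℝ, E).tangent v).symm (a, z)) =
      fun z : E => (⟨x, A z⟩ : TangentBundle 𝓘(ℝ, E) M) := funext hsymm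
  rw [e3] at e1
  have e4 := hasMFDerivAt_unique e1 e2
  have e5 := congrArg (fun l : E →L[ℝ] E × E => l y) e4
  have e6 : liouvilleField E M ((extChartAt 𝓘(ℝ, E).tangent v).symm (a, y)) =
      (liouvilleField E M ⟨x, A y⟩ : E × E) :=
    congrArg (fun w => (liouvilleField E M w : E × E)) (hsymm y)
  exact e5.trans e6.symm

theorem chartField_liouvilleField (v : TangentBundle 𝓘(ℝ, E) M) {p : E × E}
    (hp : p ∈ (extChartAt 𝓘(ℝ, E).tangent v).target) :
    chartField v (liouvilleField E M) p = (0, p.2) := by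
  rw [chartField, VectorField.mpullbackWithin_apply, ← mfderivWithin_extChartAt_symm_vertical v hp]
  exact (isInvertible_mfderivWithin_extChartAt_symm (I := 𝓘(ℝ, E).tangent)
    hp).inverse_apply_self _

theorem isOpen_slitTangentBundle : IsOpen (slitTangentBundle E M) := by
  rw [isOpen_iff_mem_nhds]
  intro v hv
  have hs := extChartAt_source_mem_nhds (I := 𝓘(ℝ, E).tangent) v
  have h2 : (extChartAt 𝓘(ℝ, E).tangent v v).2 ≠ 0 := by
    rw [TangentBundle.extChartAt_tangent_self v v rfl]
    exact hv
  have hc : ContinuousAt (fun w => (extChartAt 𝓘(ℝ, E).tangent v w).2) v :=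
    continuous_snd.continuousAt.comp (continuousAt_extChartAt v)
  filter_upwards [hs, hc.eventually_ne h2] with w _ hw h0
  apply hw
  rw [TangentBundle.extChartAt_tangent_apply]
  change tangentCoordChange 𝓘(ℝ, E) w.proj v.proj w.proj w.snd = 0
  rw [h0]
  exact map_zero _

variable (S : Spray E M)

theorem Spray.differentiableAt_chartField [CompleteSpace E] {v : TangentBundle 𝓘(ℝ, E) M}
    (hv : v ∈ slitTangentBundle E M) :
    DifferentiableAt ℝ (chartField v S.toFun) (extChartAt 𝓘(ℝ, E).tangent v v) := by
  have h1 := ((S.smooth.contMDiffAt (isOpen_slitTangentBundle.mem_nhds hv)).mdifferentiableAt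
    (by simp)).mdifferentiableWithinAt (s := univ)
  have h2 : DifferentiableWithinAt ℝ (chartField v S.toFun)
      ((extChartAt 𝓘(ℝ, E).tangent v).symm ⁻¹' univ ∩ range 𝓘(ℝ, E).tangent)
      (extChartAt 𝓘(ℝ, E).tangent v v) :=
    h1.differentiableWithinAt_mpullbackWithin_vectorField
  rwa [preimage_univ, ModelWithCorners.range_eq_univ, inter_univ, differentiableWithinAt_univ]
    at h2

/-- The identity `[C, S] = S` at `v = (x, y)` in the chart at `v`: as `C = (0, y)`, it reads
`∂S/∂y · y - (0, S₂) = (S₁, S₂)`, where `S = (S₁, S₂)`. -/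
theorem Spray.fderiv_chartField {v : TangentBundle 𝓘(ℝ, E) M}
    (hv : v ∈ slitTangentBundle E M) :
    fderiv ℝ (chartField v S.toFun) (extChartAt 𝓘(ℝ, E).tangent v v) ((0, v.snd) : E × E) =
      ((S.toFun v : E × E).1, (2 : ℝ) • (S.toFun v : E × E).2) := by
  set p := extChartAt 𝓘(ℝ, E).tangent v v with hp
  have hp2 : p.2 = v.snd := by rw [hp, TangentBundle.extChartAt_tangent_self v v rfl]
  have hinv : ∀ ξ : E × E, (mfderiv 𝓘(ℝ, E).tangent 𝓘(ℝ, E × E)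
      (extChartAt 𝓘(ℝ, E).tangent v) v).inverse ξ = ξ := fun ξ => by
    have h : mfderiv 𝓘(ℝ, E).tangent 𝓘(ℝ, E × E) (extChartAt 𝓘(ℝ, E).tangent v) v =
      ContinuousLinearMap.id ℝ (E × E) := mfderiv_extChartAt_self
    refine (congrArg (fun l : E × E →L[ℝ] E × E => l.inverse ξ) h).trans ?_
    rw [ContinuousLinearMap.inverse_id]
    rfl
  let B : E × E := VectorField.lieBracketWithin ℝ (chartField v (liouvilleField E M))
    (chartField v S.toFun)
    ((extChartAt 𝓘(ℝ, E).tangent v).symm ⁻¹' univ ∩ range 𝓘(ℝ, E).tangent) p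
  have hB : B = (S.toFun v : E × E) := (hinv B).symm.trans (S.bracket_eq v hv)
  have hb : fderiv ℝ (chartField v S.toFun) p (chartField v (liouvilleField E M) p) -
      fderiv ℝ (chartField v (liouvilleField E M)) p (chartField v S.toFun p) =
      (S.toFun v : E × E) := by
    rw [← hB]
    simp only [B]
    rw [preimage_univ, ModelWithCorners.range_eq_univ, univ_inter,
      VectorField.lieBracketWithin_univ]
    rfl
  have hev : chartField v (liouvilleField E M) =ᶠ[𝓝 p] fun q => ((0 : E), q.2) := by
    filter_upwards [extChartAt_target_mem_nhds (I := 𝓘(ℝ, E).tangent) v] with q hq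
    exact chartField_liouvilleField v hq
  have hd : HasFDerivAt (fun q : E × E => ((0 : E), q.2))
      ((0 : E × E →L[ℝ] E).prod (ContinuousLinearMap.snd ℝ E E)) p :=
    (hasFDerivAt_const (0 : E) p).prodMk hasFDerivAt_snd
  rw [hev.fderiv_eq, hd.fderiv, hev.eq_of_nhds, chartField_self, hp2] at hb
  refine (sub_eq_iff_eq_add.1 hb).trans ?_
  have key : ∀ ξ : E × E, ξ + (0 : E × E →L[ℝ] E).prod (ContinuousLinearMap.snd ℝ E E) ξ =
      (ξ.1, (2 : ℝ) • ξ.2) := fun ξ => by simp [two_smul, Prod.ext_iff]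
  exact key _

/-- The first component of a spray, in the coordinates of the base point, is homogeneous of degree
one in the fibres, the second one of degree two. -/
theorem Spray.toFun_smul [CompleteSpace E] (x : M) (y : TangentSpace 𝓘(ℝ, E) x) (hy : y ≠ 0)
    {k : ℝ} (hk : 0 < k) :
    (S.toFun ⟨x, k • y⟩ : E × E) =
      (k • (S.toFun ⟨x, y⟩ : E × E).1, k ^ 2 • (S.toFun ⟨x, y⟩ : E × E).2) := by
  -- `V z` is the tangent vector with coordinates `z` at `x`; every `V z` has the same chart
  obtain ⟨V, hV⟩ : ∃ V : E → TangentBundle 𝓘(ℝ, E) M, ∀ z, V z = ⟨x, z⟩ := ⟨_, fun _ => rfl⟩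
  obtain ⟨y', hy'⟩ : ∃ y' : E, y' = y := ⟨_, rfl⟩
  set X := chartField (V y') S.toFun with hX
  set x₀ := extChartAt 𝓘(ℝ, E) x x
  have hself : ∀ z : E, extChartAt 𝓘(ℝ, E).tangent (V z) (V z) = (x₀, z) := fun z => by
    rw [hV]
    exact TangentBundle.extChartAt_tangent_self _ _ rfl
  have hproj : ∀ z w : E, (V z).proj = (V w).proj := fun z w => by rw [hV, hV]
  have hXS : ∀ z : E, X (x₀, z) = (S.toFun (V z) : E × E) := fun z => by
    rw [← hself z, hX, chartField_eq_of_proj_eq (hproj y' z), chartField_self]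
  have hslit : ∀ r : ℝ, 0 < r → V (r • y') ∈ slitTangentBundle E M := fun r hr => by
    rw [hV, hy']
    exact smul_ne_zero hr.ne' hy
  -- Euler's equation along the ray through `y`
  have hder : ∀ r : ℝ, 0 < r → ∃ w : E × E, HasDerivAt (fun r : ℝ => X (x₀, r • y')) w r ∧
      r • w = ((X (x₀, r • y')).1, (2 : ℝ) • (X (x₀, r • y')).2) := fun r hr => by
    have hd := S.differentiableAt_chartField (hslit r hr)
    have hf : fderiv ℝ (chartField (V (r • y')) S.toFun)
        (extChartAt 𝓘(ℝ, E).tangent (V (r • y')) (V (r • y'))) (0, r • y') =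
        ((S.toFun (V (r • y')) : E × E).1, (2 : ℝ) • (S.toFun (V (r • y')) : E × E).2) := by
      refine Eq.trans ?_ (S.fderiv_chartField (hslit r hr))
      rw [hV]
    rw [hself, chartField_eq_of_proj_eq (hproj _ y'), ← hX] at hd hf
    refine ⟨fderiv ℝ X (x₀, r • y') (0, y'), ?_, ?_⟩
    · refine hd.hasFDerivAt.comp_hasDerivAt r ?_
      have := (hasDerivAt_id r).smul_const y'
      simp only [id, one_smul] at this
      exact (hasDerivAt_const r x₀).prodMk this
    · rw [← map_smul, hXS, ← hf]
      simp
  have h1 := eq_pow_smul_of_euler (f := fun r => (X (x₀, r • y')).1) (n := 1) (fun r hr => by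
    obtain ⟨w, hw, hrw⟩ := hder r hr
    exact ⟨w.1, hw.fst, by simpa using congrArg Prod.fst hrw⟩) hk
  have h2 := eq_pow_smul_of_euler (f := fun r => (X (x₀, r • y')).2) (n := 2) (fun r hr => by
    obtain ⟨w, hw, hrw⟩ := hder r hr
    exact ⟨w.2, hw.snd, by simpa using congrArg Prod.snd hrw⟩) hk
  simp only [one_smul, pow_one] at h1 h2
  rw [hXS, hXS] at h1 h2
  rw [hV, hV, hy'] at h1 h2
  exact Prod.ext h1 h2

end SprayHomogeneity

/-! ### Rescaling geodesics of a spray -/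

section SprayGeodesics

variable {E : Type*} [NormedAddCommGroup E] [NormedSpace ℝ E]
  {M : Type*} [TopologicalSpace M] [ChartedSpace E M] [IsManifold 𝓘(ℝ, E) ∞ M]

/-- The derivative of a curve in `TM`, computed in the chart at the point in question. -/
theorem hasMFDerivAt_curve_iff {W : ℝ → TangentBundle 𝓘(ℝ, E) M} {t : ℝ}
    {ξ : TangentSpace 𝓘(ℝ, E).tangent (W t)} :
    HasMFDerivAt 𝓘(ℝ, ℝ) 𝓘(ℝ, E).tangent W t ((1 : ℝ →L[ℝ] ℝ).smulRight ξ) ↔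
      ContinuousAt W t ∧
        HasDerivAt (fun s => (extChartAt 𝓘(ℝ, E).tangent (W t) (W s) : E × E)) (ξ : E × E) t := by
  have hd : ∀ (f : ℝ → E × E) (η : E × E), HasFDerivWithinAt f
      ((1 : ℝ →L[ℝ] ℝ).smulRight η) (range 𝓘(ℝ, ℝ)) t ↔ HasDerivAt f η t := fun f η => by
    have hl : (1 : ℝ →L[ℝ] ℝ).smulRight η = ContinuousLinearMap.toSpanSingleton ℝ η := by
      ext <;> simp
    rw [ModelWithCorners.range_eq_univ, hasFDerivWithinAt_univ, hasDerivAt_iff_hasFDerivAt, hl]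
  exact ⟨fun h => ⟨h.1, (hd _ _).1 h.2⟩, fun h => ⟨h.1, (hd _ _).2 h.2⟩⟩

/-- A curve in `TM` is continuous if its projection to `M` and its expression in the chart are; the
former keeps the curve in the domain of the chart. -/
theorem continuousAt_of_extChartAt_tangent {W : ℝ → TangentBundle 𝓘(ℝ, E) M} {t : ℝ}
    (hproj : ContinuousAt (fun s => (W s).proj) t)
    (h : ContinuousAt (fun s => (extChartAt 𝓘(ℝ, E).tangent (W t) (W s) : E × E)) t) :
    ContinuousAt W t := by
  have hsrc : ∀ᶠ s in 𝓝 t, (W s).proj ∈ (chartAt E (W t).proj).source :=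
    hproj.eventually ((chartAt E (W t).proj).open_source.mem_nhds (mem_chart_source E _))
  have he : W =ᶠ[𝓝 t] fun s => (extChartAt 𝓘(ℝ, E).tangent (W t)).symm
      (extChartAt 𝓘(ℝ, E).tangent (W t) (W s)) := by
    filter_upwards [hsrc] with s hs
    exact ((extChartAt 𝓘(ℝ, E).tangent (W t)).left_inv
      (TangentBundle.mem_extChartAt_tangent_source.2 hs)).symm
  refine ContinuousAt.congr ?_ he.symm
  exact ContinuousAt.comp (f := fun s => extChartAt 𝓘(ℝ, E).tangent (W t) (W s))
    (continuousAt_extChartAt_symm (W t)) h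

theorem Spray.geodesics_hasMFDerivAt {S : Spray E M} {γ : ℝ → M} {I : Set ℝ}
    (h : S.geodesics γ I) {t : ℝ} (ht : t ∈ I) :
    HasMFDerivAt 𝓘(ℝ, ℝ) 𝓘(ℝ, E).tangent (velocity E γ) t
      ((1 : ℝ →L[ℝ] ℝ).smulRight (S.toFun (velocity E γ t))) :=
  (h.2.2 t ht).hasMFDerivAt (h.1.1.mem_nhds ht)

/-- If `V` is the velocity of a geodesic, then `k V (k t + d)` has in coordinates the derivative
`(k S₁, k² S₂)` at the point `k V`, which is `S (k V)` by homogeneity. -/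
theorem Spray.affineInvariant_geodesics [CompleteSpace E] (S : Spray E M) :
    S.geodesics.AffineInvariant := by
  intro γ J hγ k d hk γ' I hI h
  have hvel := fun t (ht : t ∈ I) => velocity_affine (E := E) hI hγ.2.1 h ht
  refine ⟨hI, fun t ht => ?_, fun t₀ ht₀ => HasMFDerivAt.hasMFDerivWithinAt ?_⟩
  · rw [hvel t ht]
    exact smul_mem_slitTangentBundle hk.ne' (hγ.2.1 _ (h t ht).1)
  set v := velocity E γ (k * t₀ + d) with hv
  have hproj : (velocity E γ' t₀).proj = v.proj := (h t₀ ht₀).2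
  obtain ⟨-, hder⟩ := hasMFDerivAt_curve_iff.1 (S.geodesics_hasMFDerivAt hγ (h t₀ ht₀).1)
  rw [← hv] at hder
  have hder' : HasDerivAt
      (fun t => (extChartAt 𝓘(ℝ, E).tangent (velocity E γ' t₀) (velocity E γ' t) : E × E))
      (S.toFun (velocity E γ' t₀) : E × E) t₀ := by
    rw [TangentBundle.extChartAt_tangent_eq_of_proj_eq hproj]
    have h1 := hder.scomp t₀ (Real.hasDerivAt_affine k d t₀)
    have h1f : HasDerivAt _ (k • (S.toFun v : E × E).1) t₀ := h1.fst
    have h1s : HasDerivAt _ (k • (S.toFun v : E × E).2) t₀ := h1.snd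
    have h2 := h1f.prodMk (h1s.const_smul k)
    have hS : (S.toFun (velocity E γ' t₀) : E × E) =
        (k • (S.toFun v : E × E).1, k ^ 2 • (S.toFun v : E × E).2) := by
      rw [hvel t₀ ht₀]
      exact S.toFun_smul _ v.snd (hγ.2.1 _ (h t₀ ht₀).1) hk
    rw [hS]
    have h3 : k ^ 2 • (S.toFun v : E × E).2 = k • k • (S.toFun v : E × E).2 := by
      rw [sq, mul_smul]
    rw [h3]
    refine h2.congr_of_eventuallyEq ?_
    filter_upwards [hI.1.mem_nhds ht₀] with t ht
    rw [hvel t ht]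
    exact TangentBundle.extChartAt_tangent_smul v _ (velocity E γ (k * t + d)).snd k
  refine hasMFDerivAt_curve_iff.2 ⟨?_, hder'⟩
  refine continuousAt_of_extChartAt_tangent ?_ hder'.continuousAt
  refine (mdifferentiableAt_of_velocity_mem (E := E) (γ := γ') ?_).continuousAt
  rw [hvel t₀ ht₀]
  exact smul_mem_slitTangentBundle hk.ne' (hγ.2.1 _ (h t₀ ht₀).1)

end SprayGeodesics

/-! ### Geodesic orbit sprays on homogeneous spaces -/

section Homogeneous

variable {E : Type*} [NormedAddCommGroup E] [NormedSpace ℝ E]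
  {M : Type*} [TopologicalSpace M] [ChartedSpace E M]
  {G : Type*} [Group G] [MulAction G M]

theorem velocity_smul (hG : ∀ g : G, ContMDiff 𝓘(ℝ, E) 𝓘(ℝ, E) ∞ fun x : M => g • x) (g : G)
    {γ : ℝ → M} {t : ℝ} (h : velocity E γ t ∈ slitTangentBundle E M) :
    velocity E (fun s => g • γ s) t = tangentAction E g (velocity E γ t) :=
  velocity_comp_map (mdifferentiableAt_of_velocity_mem h)
    ((hG g).mdifferentiableAt (by simp))

theorem tangentAction_mem_slit (hG : ∀ g : G, ContMDiff 𝓘(ℝ, E) 𝓘(ℝ, E) ∞ fun x : M => g • x)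
    (g : G) {v : TangentBundle 𝓘(ℝ, E) M} (hv : v ∈ slitTangentBundle E M) :
    tangentAction E g v ∈ slitTangentBundle E M := by
  intro h0
  apply hv
  have h1 := (((hG g⁻¹).mdifferentiableAt (x := g • v.proj) (by simp)).hasMFDerivAt).comp v.proj
    ((hG g).mdifferentiableAt (x := v.proj) (by simp)).hasMFDerivAt
  have h2 : (fun x : M => g⁻¹ • x) ∘ (fun x : M => g • x) = id := by
    ext x
    simp
  rw [h2] at h1
  have h3 := hasMFDerivAt_unique h1 (hasMFDerivAt_id v.proj)
  have h4 : mfderiv 𝓘(ℝ, E) 𝓘(ℝ, E) (fun x : M => g⁻¹ • x) (g • v.proj)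
      (mfderiv 𝓘(ℝ, E) 𝓘(ℝ, E) (fun x : M => g • x) v.proj v.snd) = v.snd :=
    congrArg (fun l : E →L[ℝ] E => l v.snd) h3
  have h0' : mfderiv 𝓘(ℝ, E) 𝓘(ℝ, E) (fun x : M => g • x) v.proj v.snd = 0 := h0
  rw [← h4, h0']
  exact map_zero _

variable [IsManifold 𝓘(ℝ, E) ∞ M]

theorem Spray.geodesics_smul (hG : ∀ g : G, ContMDiff 𝓘(ℝ, E) 𝓘(ℝ, E) ∞ fun x : M => g • x)
    {S : Spray E M} (hS : S.Invariant G) (g : G) {γ : ℝ → M} {I : Set ℝ} (h : S.geodesics γ I) :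
    S.geodesics (fun t => g • γ t) I := by
  refine ⟨h.1, fun t ht => ?_, fun t ht => HasMFDerivAt.hasMFDerivWithinAt ?_⟩
  · rw [velocity_smul hG g (h.2.1 t ht)]
    exact tangentAction_mem_slit hG g (h.2.1 t ht)
  have hT : MDifferentiableAt 𝓘(ℝ, E).tangent 𝓘(ℝ, E).tangent (tangentAction E g)
      (velocity E γ t) :=
    ((hG g).contMDiff_tangentMap (m := 1) (by norm_cast)).mdifferentiableAt (by simp)
  have h1 := hT.hasMFDerivAt.comp t (S.geodesics_hasMFDerivAt h ht)
  have he : velocity E (fun t => g • γ t) =ᶠ[𝓝 t] tangentAction E g ∘ velocity E γ := by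
    filter_upwards [h.1.1.mem_nhds ht] with s hs
    exact velocity_smul hG g (h.2.1 s hs)
  have h2 := h1.congr_of_eventuallyEq he
  have hval : (S.toFun (velocity E (fun t => g • γ t) t) : E × E) =
      mfderiv 𝓘(ℝ, E).tangent 𝓘(ℝ, E).tangent (tangentAction E g) (velocity E γ t)
        (S.toFun (velocity E γ t)) := by
    rw [velocity_smul hG g (h.2.1 t ht)]
    exact hS g _ (h.2.1 t ht)
  have hl : ((1 : ℝ →L[ℝ] ℝ).smulRight (S.toFun (velocity E (fun t => g • γ t) t) : E × E) :
      ℝ →L[ℝ] E × E) = (mfderiv 𝓘(ℝ, E).tangent 𝓘(ℝ, E).tangent (tangentAction E g)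
        (velocity E γ t)).comp ((1 : ℝ →L[ℝ] ℝ).smulRight (S.toFun (velocity E γ t))) := by
    rw [hval]
    refine ContinuousLinearMap.ext fun r => ?_
    exact (map_smul (mfderiv 𝓘(ℝ, E).tangent 𝓘(ℝ, E).tangent (tangentAction E g)
        (velocity E γ t)) r (S.toFun (velocity E γ t))).symm
  exact hl ▸ h2

variable {EG : Type*} [NormedAddCommGroup EG] [NormedSpace ℝ EG]
  [TopologicalSpace G] [ChartedSpace EG G]

/-- An invariant function on `TM` is constant along the geodesics of a geodesic orbit spray. By
transitivity the geodesic may be moved to start at `o`; it is then `t ↦ a t • o` for a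
one-parameter subgroup `a`, and its velocity at time `τ` is the image of the one at time `0` under
the action of `a τ`. -/
theorem Spray.IsGeodesicOrbit.conserves [CompleteSpace E] [MulAction.IsPretransitive G M]
    (hG : ∀ g : G, ContMDiff 𝓘(ℝ, E) 𝓘(ℝ, E) ∞ fun x : M => g • x)
    {S : Spray E M} {o : M} (hS : S.IsGeodesicOrbit EG G o)
    {L : TangentBundle 𝓘(ℝ, E) M → ℝ} (hL : ∀ (g : G) v, L (tangentAction E g v) = L v) :
    S.geodesics.Conserves L := by
  intro γ I hγ s hs t ht
  obtain ⟨g, hg⟩ := MulAction.exists_smul_eq G (γ s) o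
  have hshift : ∀ r : ℝ, 1 * r + s = r + s := fun r => by ring
  -- the geodesic, translated in time by `s` and by `g`, starts at `o`
  set I' : Set ℝ := (fun r => r + s) ⁻¹' I with hI'
  have hI'o : IsOpenInterval I' :=
    ⟨hγ.1.1.preimage (by fun_prop), hγ.1.2.1.preimage_mono fun a b hab => by simpa using hab,
      ⟨0, by simpa [hI'] using hs⟩⟩
  have hδ : S.geodesics (fun r => γ (r + s)) I' :=
    S.affineInvariant_geodesics γ I hγ 1 s one_pos _ I' hI'o fun r hr => by
      rw [hshift]
      exact ⟨hr, rfl⟩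
  have hε := Spray.geodesics_smul hG hS.1 g hδ
  set ε : ℝ → M := fun r => g • γ (r + s) with hεdef
  have h0 : (0 : ℝ) ∈ I' := by simpa [hI'] using hs
  obtain ⟨a, ⟨-, ha⟩, hao⟩ := hS.2 ε I' hε h0 (by simpa [hεdef] using hg)
  have hLε : ∀ r, r ∈ I' → L (velocity E ε r) = L (velocity E γ (r + s)) := fun r hr => by
    rw [velocity_smul hG g (hδ.2.1 r hr), hL]
    have := velocity_affine (E := E) (k := 1) (d := s) hI'o hγ.2.1
      (γ' := fun r => γ (r + s)) (fun r hr => by rw [hshift]; exact ⟨hr, rfl⟩) hr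
    rw [this, hshift, one_smul]
    rfl
  -- the one-parameter group moves the velocity at time `0` to the velocity at time `τ`
  have hLc : ∀ τ, τ ∈ I' → L (velocity E ε τ) = L (velocity E ε 0) := fun τ hτ => by
    have he : (fun r => ε (r + τ)) =ᶠ[𝓝 0] fun r => a τ • ε r := by
      have h1 : ∀ᶠ r in 𝓝 (0 : ℝ), r + τ ∈ I' :=
        (continuous_add_const τ).continuousAt.eventually
          (hI'o.1.mem_nhds (by simpa using hτ))
      filter_upwards [h1, hI'o.1.mem_nhds h0] with r hr hr'
      rw [hao _ hr, hao _ hr', add_comm, ha, mul_smul]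
    have hd : HasDerivAt (fun r : ℝ => r + τ) 1 0 := (hasDerivAt_id _).add_const τ
    have h2 := velocity_comp_real (E := E) (γ := ε) (φ := fun r => r + τ) (t := 0)
      (by simpa using mdifferentiableAt_of_velocity_mem (hε.2.1 τ hτ)) hd
    have h3 := velocity_congr (E := E) he
    rw [velocity_smul hG (a τ) (hε.2.1 0 h0)] at h3
    have h4 := h2.symm.trans h3
    rw [one_smul, zero_add] at h4
    rw [← hL (a τ) (velocity E ε 0), ← h4]
    rfl
  have h1 := hLε (t - s) (by simpa [hI'] using ht)
  have h2 := hLε 0 h0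
  rw [sub_add_cancel] at h1
  rw [zero_add] at h2
  exact h2.symm.trans ((hLc _ (by simpa [hI'] using ht)).symm.trans h1)

theorem Spray.IsGeodesicOrbit.projEquiv_iff_coincide [CompleteSpace E]
    [MulAction.IsPretransitive G M]
    (hG : ∀ g : G, ContMDiff 𝓘(ℝ, E) 𝓘(ℝ, E) ∞ fun x : M => g • x)
    {S : Spray E M} {o : M} (hS : S.IsGeodesicOrbit EG G o)
    {L : TangentBundle 𝓘(ℝ, E) M → ℝ} (hL : IsEnergyFunction L)
    (hLG : ∀ (g : G) v, L (tangentAction E g v) = L v) :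
    S.geodesics.ProjEquiv (energyGeodesics L) ↔ S.geodesics.Coincide (energyGeodesics L) :=
  ⟨CurveFamily.Coincide.of_projEquiv hL (fun _ _ h => ⟨h.1, h.2.1⟩) (fun _ _ h => ⟨h.1, h.2.2.1⟩)
    (hS.conserves hG hLG) hL.conserves_energyGeodesics S.affineInvariant_geodesics
    hL.affineInvariant_energyGeodesics,
    CurveFamily.Coincide.projEquiv fun _ _ h => h.1⟩

end Homogeneous

/-! ### Energies of Riemann and Finsler metrics -/

section Metrics

variable {E : Type*} [NormedAddCommGroup E] [NormedSpace ℝ E]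
  {M : Type*} [TopologicalSpace M] [ChartedSpace E M] [IsManifold 𝓘(ℝ, E) ∞ M]

theorem isEnergyFunction_riemannEnergy (g : RiemannMetric E M) :
    IsEnergyFunction (riemannEnergy g) where
  mdifferentiableAt v _ := by
    have h1 : ContMDiff 𝓘(ℝ, E).tangent (𝓘(ℝ, E).prod 𝓘(ℝ, E →L[ℝ] E →L[ℝ] ℝ)) 1
        (fun w : TangentBundle 𝓘(ℝ, E) M =>
          TotalSpace.mk' (E →L[ℝ] E →L[ℝ] ℝ)
            (E := fun x : M => TangentSpace 𝓘(ℝ, E) x →L[ℝ] TangentSpace 𝓘(ℝ, E) x →L[ℝ] ℝ)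
            w.proj (g.inner w.proj)) :=
      (g.contMDiff.of_le (by norm_cast)).comp (contMDiff_proj _)
    have h2 : ContMDiff 𝓘(ℝ, E).tangent (𝓘(ℝ, E).prod 𝓘(ℝ, E)) 1
        (fun w : TangentBundle 𝓘(ℝ, E) M => (⟨w.proj, w.snd⟩ : TangentBundle 𝓘(ℝ, E) M)) :=
      contMDiff_id
    have h3 := ContMDiff.clm_bundle_apply₂ (F₁ := E) (F₂ := E) (F₃ := ℝ)
       (E₁ := fun x : M => TangentSpace 𝓘(ℝ, E) x) (E₂ := fun x : M => TangentSpace 𝓘(ℝ, E) x)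
       (E₃ := Bundle.Trivial M ℝ) h1 h2 h2
    have h4 := (contMDiffAt_totalSpace.1 (h3 v)).2.mdifferentiableAt one_ne_zero
    have h5 : MDifferentiableAt 𝓘(ℝ, ℝ) 𝓘(ℝ, ℝ) (fun r : ℝ => r / 2)
        (g.inner v.proj v.snd v.snd) :=
      DifferentiableAt.mdifferentiableAt (by fun_prop)
    exact h5.comp v h4
  smul x y c _ := by
    simp only [riemannEnergy, map_smul, smul_apply, smul_eq_mul]
    ring
  pos v hv := half_pos (g.pos v.proj v.snd hv)

theorem FinslerMetric.isEnergyFunction_energy (F : FinslerMetric E M) :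
    IsEnergyFunction F.energy where
  mdifferentiableAt v hv := by
    have h1 : MDifferentiableAt 𝓘(ℝ, E).tangent 𝓘(ℝ, ℝ) F.F v :=
      (F.smooth.contMDiffAt (isOpen_slitTangentBundle.mem_nhds hv)).mdifferentiableAt (by simp)
    have h2 : MDifferentiableAt 𝓘(ℝ, ℝ) 𝓘(ℝ, ℝ) (fun r : ℝ => r ^ 2 / 2) (F.F v) :=
      DifferentiableAt.mdifferentiableAt (by fun_prop)
    exact h2.comp v h1
  smul x y c hc := by
    simp only [FinslerMetric.energy, F.homogeneous x y c hc.le]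
    ring
  pos v hv := by
    have := F.pos v hv
    simp only [FinslerMetric.energy]
    positivity

end Metrics

theorem proposition5p5
    {EG : Type*} [NormedAddCommGroup EG] [NormedSpace ℝ EG] [FiniteDimensional ℝ EG]
    {G : Type*} [TopologicalSpace G] [ChartedSpace EG G] [Group G] [LieGroup 𝓘(ℝ, EG) ∞ G]
    {E : Type*} [NormedAddCommGroup E] [NormedSpace ℝ E] [FiniteDimensional ℝ E]
    {M : Type*} [TopologicalSpace M] [T2Space M] [ConnectedSpace M]
    [ChartedSpace E M] [IsManifold 𝓘(ℝ, E) ∞ M]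
    [MulAction G M] [ContMDiffSMul 𝓘(ℝ, EG) 𝓘(ℝ, E) ∞ G M] [MulAction.IsPretransitive G M]
    (o : M) (S : Spray E M) (hS : S.IsGeodesicOrbit EG G o) :
    (S.InvProjRiemannMetrizable G ↔ S.InvRiemannMetrizable G) ∧
    (S.InvProjFinslerMetrizable G ↔ S.InvFinslerMetrizable G) := by
  have : CompleteSpace E := FiniteDimensional.complete ℝ E
  have hG : ∀ g : G, ContMDiff 𝓘(ℝ, E) 𝓘(ℝ, E) ∞ fun x : M => g • x := fun g =>
    ContMDiffSMul.contMDiff_const_smul (I := 𝓘(ℝ, EG)) g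
  refine ⟨exists_congr fun g => and_congr_right fun hg => ?_,
    exists_congr fun F => and_congr_right fun hF => ?_⟩
  · refine hS.projEquiv_iff_coincide hG (isEnergyFunction_riemannEnergy g) fun a v => ?_
    exact congrArg (· / 2) (hg a v.proj v.snd v.snd)
  · refine hS.projEquiv_iff_coincide hG F.isEnergyFunction_energy fun a v => ?_
    simp only [FinslerMetric.energy, hF a v]
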